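/- **Quantum query model.** Let $G$ be a finite abelian group and $A:X\to G$ a function on a finite set. A $q$-query quantum algorithm acts on a query register with basis $X$, a response register and a workspace of arbitrary finite dimension. It starts in an arbitrary unit vector, makes $q$ queries to $A$, each followed by an arbitrary unitary that does not depend on $A$, then measures in the computational basis and outputs a function of the result. A query is the unitary $|x,g,z\rangle\mapsto|x,g+A(x),z\rangle$ with $g\in G$ (controlled-add model) or $|x,\xi,z\rangle\mapsto\xi(A(x))\,|x,\xi,z\rangle$ with $\xi$ a character of $G$ (phase model). **Theorem.** Let $\mathbb F$ be a finite field and let $q\ge 1$ and $d$ be integers with $q\le d/2$. Let $A(x)=\sum_{i=0}^d c_i x^i$ with $(c_0,\dots,c_d)$ uniformly random in $\mathbb F^{d+1}$. Then, in either query model, every $q$-query quantum algorithm with access to $A:\mathbb F\to\mathbb F$ outputs $q+1$ pairs $(x_i,A(x_i))$ with pairwise distinct inputs $x_i\in\mathbb F$ with probability at most $$\frac{(q+1)\,q\,e^{2\sqrt q}}{|\mathbb F|},$$ the probability being over the choice of $A$ and the measurement. Consequently, polynomials of degree at most $2q$ are quantum-secure $q$-time message authentication codes (MACs), in the following sense.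 Let $(\mathbb F_n)_{n\in\mathbb N}$ be finite fields, where $n$ is the security parameter, and call a function of $n$ negligible if it is $o(n^{-c})$ for every $c$. The key is a uniformly random coefficient vector of a polynomial $A$ of degree at most $2q$ over $\mathbb F_n$, and the tag of a message $x\in\mathbb F_n$ is $A(x)$. If $q\ge1$ is fixed and $1/|\mathbb F_n|$ is negligible, then every (computationally unbounded) quantum adversary that makes $q$ controlled-add queries to $A$ outputs $q+1$ valid message/tag pairs with distinct messages with only negligible probability. The same holds for $q=q(n)\ge1$ depending on $n$ whenever $(q(n)+1)\,q(n)\,e^{2\sqrt{q(n)}}/|\mathbb F_n|$ is negligible. -/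

import Mathlib

open Filter

noncomputable section

namespace QuantumQuery

/-- Pure states on three registers: a query register with basis `X`, a response register with
basis `Y`, and a workspace of arbitrary finite dimension `w`. -/
abbrev QState (X Y : Type*) [Fintype X] [Fintype Y] (w : ℕ) : Type _ :=
  EuclideanSpace ℂ (X × Y × Fin w)

/-- A quantum algorithm making `q` oracle queries. It starts in an arbitrary unit vector, applies
an arbitrary unitary after each query, finally measures all registers in the computational basis
and outputs a function of the measurement result. -/
structure QueryAlgorithm (X Y : Type*) [Fintype X] [Fintype Y] (q : ℕ) (Out : Type*) where
  /-- dimension of the workspace register -/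
  w : ℕ
  /-- state before the first query -/
  init : QState X Y w
  norm_init : ‖init‖ = 1
  /-- unitary applied after each query -/
  gate : Fin q → (QState X Y w ≃ₗᵢ[ℂ] QState X Y w)
  /-- output computed from the measured basis element -/
  out : X × Y × Fin w → Out

/-- The controlled-add query to `A`: the linear map with `|x, g, z⟩ ↦ |x, g + A x, z⟩`. -/
def addQuery {X G : Type*} [Fintype X] [Fintype G] [AddCommGroup G] (A : X → G) {w : ℕ}
    (ψ : QState X G w) : QState X G w :=
  WithLp.toLp 2 fun b => ψ (b.1, b.2.1 - A b.1, b.2.2)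

/-- The phase query to `A`: the linear map with `|x, ξ, z⟩ ↦ ξ(A x) |x, ξ, z⟩`, where `ξ` ranges
over the characters of `G`. -/
def phaseQuery {X G : Type*} [Fintype X] [Fintype G] [AddCommGroup G] (A : X → G) {w : ℕ}
    (ψ : QState X (AddChar G ℂ) w) : QState X (AddChar G ℂ) w :=
  WithLp.toLp 2 fun b => b.2.1 (A b.1) * ψ b

/-- The state just before the final measurement, when each query is answered by `query`. -/
def QueryAlgorithm.finalState {X Y : Type*} [Fintype X] [Fintype Y] {q : ℕ} {Out : Type*}
    (Q : QueryAlgorithm X Y q Out) (query : QState X Y Q.w → QState X Y Q.w) : QState X Y Q.w :=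
  Fin.foldl q (fun ψ i => Q.gate i (query ψ)) Q.init

open Classical in
/-- Probability (Born rule) that the output of `Q` satisfies `good`, when each query is answered
by `query`. -/
def QueryAlgorithm.prob {X Y : Type*} [Fintype X] [Fintype Y] {q : ℕ} {Out : Type*}
    (Q : QueryAlgorithm X Y q Out) (query : QState X Y Q.w → QState X Y Q.w)
    (good : Out → Prop) : ℝ :=
  ∑ b : X × Y × Fin Q.w, if good (Q.out b) then ‖Q.finalState query b‖ ^ 2 else 0

/-- The list `y` consists of input/output pairs of `A` with pairwise distinct inputs. -/
def CorrectPairs {X G : Type*} {k : ℕ} (A : X → G) (y : Fin k → X × G) : Prop :=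
  Function.Injective (fun i => (y i).1) ∧ ∀ i, A (y i).1 = (y i).2

/-- Probability, over a uniformly random `κ : K` and the measurement, that `Q` with
controlled-add query access to `A κ` outputs `k` correct pairs of `A κ` with distinct inputs. -/
def addSuccess {K X G : Type*} [Fintype K] [Fintype X] [Fintype G] [AddCommGroup G] {q k : ℕ}
    (A : K → X → G) (Q : QueryAlgorithm X G q (Fin k → X × G)) : ℝ :=
  (∑ κ : K, Q.prob (addQuery (A κ)) (CorrectPairs (A κ))) / Fintype.card K

/-- The same probability for an algorithm with phase query access to `A κ`. -/
def phaseSuccess {K X G : Type*} [Fintype K] [Fintype X] [Fintype G] [AddCommGroup G] {q k : ℕ}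
    (A : K → X → G) (Q : QueryAlgorithm X (AddChar G ℂ) q (Fin k → X × G)) : ℝ :=
  (∑ κ : K, Q.prob (phaseQuery (A κ)) (CorrectPairs (A κ))) / Fintype.card K

/-- The function computed by the polynomial of degree at most `d` with coefficients `c`. A random
degree-`d` polynomial is given by uniformly random `c`. -/
def polyFun {F : Type*} [Field F] (d : ℕ) (c : Fin (d + 1) → F) (x : F) : F :=
  (∑ i : Fin (d + 1), Polynomial.monomial (i : ℕ) (c i)).eval x

/-- A function of the security parameter is negligible if it decays faster than every inverse
polynomial. -/
def Negligible (f : ℕ → ℝ) : Prop :=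
  Asymptotics.SuperpolynomialDecay atTop (fun n : ℕ => (n : ℝ)) f

/-- A MAC, given for each security parameter `n` by the tagging function `tag n κ : M n → T n` of
a uniformly random key `κ : K n`, is a quantum-secure `q`-time MAC if every (computationally
unbounded) adversary that makes `q n` quantum queries to the tagging function produces `q n + 1`
valid message/tag pairs with distinct messages with only negligible probability. -/
def IsQuantumSecureMAC (q : ℕ → ℕ) {K M T : ℕ → Type*} [∀ n, Fintype (K n)]
    [∀ n, Fintype (M n)] [∀ n, Fintype (T n)] [∀ n, AddCommGroup (T n)]
    (tag : ∀ n, K n → M n → T n) : Prop :=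
  ∀ Q : ∀ n, QueryAlgorithm (M n) (T n) (q n) (Fin (q n + 1) → M n × T n),
    Negligible fun n => addSuccess (tag n) (Q n)

end QuantumQuery

end

/-! Fix a measurement outcome. Its amplitude, as a function of the oracle `A : X → G`, is a
combination of product characters of weight at most `q`, since each query raises the weight by at
most one. The outcome names `q + 1` pairs on a set `S` of inputs, and the keys consistent with them
form a coset of the subgroup `V` of keys vanishing on `S` (or there are none). Characters restricted
to `V` may coincide, so Parseval there loses a factor `T`, the largest number that coincide
(`sum_norm_sq_sum_char_le`). On all functions `X → G` the characters are distinct, so the squared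
coefficients sum to the outcome's probability for a uniformly random function; over all outcomes
these add up to 1. As `V` has density at most `|G|^-(q+1)`, success is at most `T / |G|^(q+1)`.
Interpolation at `2q + 1` points bounds `T` (`card_collision_le`): once the support off `S` is
chosen, only the values on `S` remain free. -/

noncomputable section

namespace QuantumQuery

open Finset

/-! ### Parseval for characters that may coincide -/

section CharacterSums

variable {H ι : Type*} [AddCommGroup H] [Fintype H]

open Classical in
theorem sum_norm_sq_sum_char (s : Finset ι) (a : ι → ℂ) (χ : ι → AddChar H ℂ) :
    ((∑ h, ‖∑ i ∈ s, a i * χ i h‖ ^ 2 : ℝ) : ℂ) =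
      Fintype.card H * ∑ i ∈ s, ∑ j ∈ s with χ j = χ i, a i * star (a j) := by
  have key (i j : ι) : ∑ h, χ i h * star (χ j h) =
      if χ j = χ i then (Fintype.card H : ℂ) else 0 := by
    have : ∀ h, χ i h * star (χ j h) = (χ i - χ j) h := by
      intro h
      rw [AddChar.sub_apply, AddChar.map_neg_eq_conj]
      rfl
    simp_rw [this, AddChar.sum_eq_ite, sub_eq_zero, eq_comm (a := χ i)]
  push_cast
  simp_rw [← Complex.mul_conj', map_sum, Finset.sum_mul_sum, Finset.mul_sum]
  rw [Finset.sum_comm]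
  refine Finset.sum_congr rfl fun i _ => ?_
  rw [Finset.sum_comm, Finset.sum_filter]
  refine Finset.sum_congr rfl fun j _ => ?_
  have : ∀ h, a i * χ i h * (starRingEnd ℂ) (a j * χ j h) =
      a i * star (a j) * (χ i h * star (χ j h)) := by
    intro h
    rw [map_mul]
    simp only [starRingEnd_apply]
    ring
  simp_rw [this, ← Finset.mul_sum, key]
  split_ifs <;> ring

theorem sum_norm_sq_sum_char_of_injective (s : Finset ι) (a : ι → ℂ) (χ : ι → AddChar H ℂ)
    (hχ : Function.Injective χ) :
    ∑ h, ‖∑ i ∈ s, a i * χ i h‖ ^ 2 = Fintype.card H * ∑ i ∈ s, ‖a i‖ ^ 2 := by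
  classical
  have h := sum_norm_sq_sum_char s a χ
  rw [← Complex.ofReal_inj, h]
  push_cast
  congr 1
  refine Finset.sum_congr rfl fun i hi => ?_
  have : s.filter (fun j => χ j = χ i) = {i} := by
    ext j
    simp only [mem_filter, mem_singleton, hχ.eq_iff]
    exact ⟨fun h => h.2, fun h => ⟨h ▸ hi, h⟩⟩
  rw [this, Finset.sum_singleton, ← Complex.mul_conj']
  rfl

-- By orthogonality only pairs with equal characters survive; AM-GM on each cross term leaves every
-- `‖a i‖ ^ 2` weighted by the size of its class.
open Classical in
theorem sum_norm_sq_sum_char_le (s : Finset ι) (a : ι → ℂ) (χ : ι → AddChar H ℂ) (T : ℝ)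
    (hT : ∀ i ∈ s, ((s.filter fun j => χ j = χ i).card : ℝ) ≤ T) :
    ∑ h, ‖∑ i ∈ s, a i * χ i h‖ ^ 2 ≤ Fintype.card H * (T * ∑ i ∈ s, ‖a i‖ ^ 2) := by
  have h := congrArg norm (sum_norm_sq_sum_char s a χ)
  rw [Complex.norm_real, Real.norm_of_nonneg (by positivity), norm_mul, Complex.norm_natCast] at h
  rw [h]
  gcongr
  have hsymm : ∑ i ∈ s, ∑ j ∈ s with χ j = χ i, ‖a j‖ ^ 2 =
      ∑ i ∈ s, ∑ j ∈ s with χ j = χ i, ‖a i‖ ^ 2 := by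
    simp_rw [Finset.sum_filter]
    rw [Finset.sum_comm]
    simp_rw [eq_comm]
  calc ‖∑ i ∈ s, ∑ j ∈ s with χ j = χ i, a i * star (a j)‖
      ≤ ∑ i ∈ s, ∑ j ∈ s with χ j = χ i, (‖a i‖ ^ 2 + ‖a j‖ ^ 2) / 2 := by
        refine (norm_sum_le _ _).trans (Finset.sum_le_sum fun i _ => ?_)
        refine (norm_sum_le _ _).trans (Finset.sum_le_sum fun j _ => ?_)
        rw [norm_mul, norm_star]
        nlinarith [sq_nonneg (‖a i‖ - ‖a j‖)]
    _ = ∑ i ∈ s, ∑ j ∈ s with χ j = χ i, ‖a i‖ ^ 2 := by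
        simp_rw [← Finset.sum_div, Finset.sum_add_distrib, hsymm]
        ring
    _ = ∑ i ∈ s, ((s.filter fun j => χ j = χ i).card : ℝ) * ‖a i‖ ^ 2 := by
        simp
    _ ≤ T * ∑ i ∈ s, ‖a i‖ ^ 2 := by
        rw [Finset.mul_sum]
        gcongr with i hi
        exact hT i hi

end CharacterSums

/-! ### Product characters of bounded weight -/

section LowWeight

variable {X G : Type*} [Fintype X] [AddCommGroup G]

/-- The character `A ↦ ∏ x, z x (A x)` of the group of functions `X → G`. -/
def prodChar (z : X → AddChar G ℂ) : AddChar (X → G) ℂ where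
  toFun A := ∏ x, z x (A x)
  map_zero_eq_one' := by simp
  map_add_eq_mul' A B := by simp [AddChar.map_add_eq_mul, Finset.prod_mul_distrib]

theorem prodChar_apply (z : X → AddChar G ℂ) (A : X → G) : prodChar z A = ∏ x, z x (A x) := rfl

theorem prodChar_injective : Function.Injective (prodChar (X := X) (G := G)) := by
  classical
  intro z z' h
  funext x
  ext g
  have key (z : X → AddChar G ℂ) : prodChar z (Pi.single x g) = z x g := by
    rw [prodChar_apply, Finset.prod_eq_single x]
    · simp
    · intro y _ hy
      simp [Pi.single_eq_of_ne hy]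
    · simp
  rw [← key z, h, key]

/-- Families of characters that are trivial outside a set of at most `k` points. -/
def lowWeight (X G : Type*) [AddCommGroup G] (k : ℕ) :
    Set (X → AddChar G ℂ) :=
  {z | ∃ U : Finset X, U.card ≤ k ∧ ∀ x ∉ U, z x = 0}

/-- The span of the product characters of weight at most `k`. -/
def lowDegree (X G : Type*) [Fintype X] [AddCommGroup G] (k : ℕ) :
    Submodule ℂ ((X → G) → ℂ) :=
  Submodule.span ℂ ((fun z A => prodChar z A) '' lowWeight X G k)

theorem const_mem_lowDegree (c : ℂ) : (fun _ => c) ∈ lowDegree X G 0 := by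
  have h : (fun _ : X → G => (1 : ℂ)) ∈ lowDegree X G 0 :=
    Submodule.subset_span ⟨0, ⟨∅, by simp, by simp⟩, by ext A; simp [prodChar_apply]⟩
  convert Submodule.smul_mem _ c h using 1
  ext; simp

theorem mul_mem_lowDegree [Finite G] {k : ℕ} {f : (X → G) → ℂ} (hf : f ∈ lowDegree X G k) (x : X)
    (u : G → ℂ) : (fun A => u (A x) * f A) ∈ lowDegree X G (k + 1) := by
  classical
  have hchar (ξ : AddChar G ℂ) : (fun A => ξ (A x) * f A) ∈ lowDegree X G (k + 1) := by
    refine Submodule.span_induction (p := fun f _ =>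
      (fun A => ξ (A x) * f A) ∈ lowDegree X G (k + 1)) ?_ ?_ ?_ ?_ hf
    · rintro _ ⟨z, ⟨U, hU, hz⟩, rfl⟩
      refine Submodule.subset_span ⟨Function.update z x (ξ + z x), ⟨insert x U,
        (Finset.card_insert_le _ _).trans (by omega), fun y hy => ?_⟩, ?_⟩
      · simp only [Finset.mem_insert, not_or] at hy
        rw [Function.update_of_ne hy.1, hz y hy.2]
      · ext A
        simp only [prodChar_apply]
        rw [← Finset.mul_prod_erase _ _ (Finset.mem_univ x),
          ← Finset.mul_prod_erase _ (fun y => z y (A y)) (Finset.mem_univ x),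
          Function.update_self, AddChar.add_apply, mul_assoc]
        congr 2
        refine Finset.prod_congr rfl fun y hy => ?_
        rw [Function.update_of_ne (Finset.ne_of_mem_erase hy)]
    · convert Submodule.zero_mem (lowDegree X G (k + 1)) using 1
      ext A; simp
    · intro f g _ _ hf hg
      convert Submodule.add_mem _ hf hg using 1
      ext A; simp [mul_add]
    · intro c f _ hf
      convert Submodule.smul_mem _ c hf using 1
      ext A; simp; ring
  -- Characters span all functions on `G`, so the case of a single character suffices.
  have hu := (AddChar.complexBasis G).sum_repr u
  have : (fun A => u (A x) * f A) = ∑ ξ : AddChar G ℂ,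
      (AddChar.complexBasis G).repr u ξ • fun A => ξ (A x) * f A := by
    ext A
    nth_rw 1 [← hu]
    simp [Finset.sum_mul, mul_assoc]
  rw [this]
  exact Submodule.sum_mem _ fun ξ _ => Submodule.smul_mem _ _ (hchar ξ)

theorem exists_coeff_of_mem_lowDegree [Finite G] {k : ℕ} {f : (X → G) → ℂ} (hf : f ∈ lowDegree X G k) :
    ∃ a : (X → AddChar G ℂ) → ℂ,
      ∀ A, f A = ∑ z ∈ (lowWeight X G k).toFinite.toFinset, a z * prodChar z A := by
  rw [lowDegree, ← (lowWeight X G k).toFinite.coe_toFinset,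
    Submodule.mem_span_image_finset_iff_exists_fun'] at hf
  obtain ⟨a, rfl⟩ := hf
  exact ⟨a, fun A => by simp⟩

end LowWeight

/-! ### Collisions of characters on functions vanishing on a set -/

section Interpolation

/-- Each function can be interpolated on each set of at most `k` points by some member of the
family `ev`. -/
def Interpolates {K X G : Type*} (ev : K → X → G) (k : ℕ) : Prop :=
  ∀ U : Finset X, U.card ≤ k → ∀ y : X → G, ∃ κ, ∀ x ∈ U, ev κ x = y x

variable {K X G : Type*} [AddCommGroup K] [AddCommGroup G]

/-- The members of the family that vanish on `S`. -/
def vanishing (ev : K →+ (X → G)) (S : Finset X) : AddSubgroup K where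
  carrier := {κ | ∀ x ∈ S, ev κ x = 0}
  zero_mem' := by simp
  add_mem' := by
    intro a b ha hb x hx
    simp [ha x hx, hb x hx]
  neg_mem' := by
    intro a ha x hx
    simp [ha x hx]

theorem mem_vanishing {ev : K →+ (X → G)} {S : Finset X} {κ : K} :
    κ ∈ vanishing ev S ↔ ∀ x ∈ S, ev κ x = 0 := Iff.rfl

/-- Interpolation gives a section of restriction to `S`, so the translates of the vanishing subgroup
by the values of that section are disjoint. -/
theorem card_vanishing_mul_le [Fintype K] [Fintype G] {ev : K →+ (X → G)} {k : ℕ}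
    (hev : Interpolates ev k) {S : Finset X} (hS : S.card ≤ k) :
    Nat.card (vanishing ev S) * Fintype.card G ^ S.card ≤ Fintype.card K := by
  classical
  choose sec hsec using fun y : S → G => hev S hS fun x => if h : x ∈ S then y ⟨x, h⟩ else 0
  have hsec' (y : S → G) (x : S) : ev (sec y) x = y x := by
    rw [hsec y x x.2, dif_pos x.2]
  have hinj : Function.Injective fun p : vanishing ev S × (S → G) => (p.1 : K) + sec p.2 := by
    rintro ⟨κ, y⟩ ⟨κ', y'⟩ h
    have hy : y = y' := by
      ext x
      have := congrFun (congrArg ev h) x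
      simpa [mem_vanishing.1 κ.2 x x.2, mem_vanishing.1 κ'.2 x x.2, hsec'] using this
    subst hy
    simpa using h
  have := Nat.card_le_card_of_injective _ hinj
  simpa [Nat.card_prod] using this

variable [Fintype X]

/-- Interpolating a point mass at `x` on `U ∪ S` gives a vanishing key whose product character reads
off `z x` alone. -/
theorem eq_of_prodChar_eq_on_vanishing {ev : K →+ (X → G)} {k : ℕ} (hev : Interpolates ev k)
    {S U : Finset X} (hUS : U.card + S.card ≤ k) {z z' : X → AddChar G ℂ}
    (hz : ∀ x ∉ U, x ∉ S → z x = 0) (hz' : ∀ x ∉ U, x ∉ S → z' x = 0)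
    (h : ∀ κ ∈ vanishing ev S, prodChar z (ev κ) = prodChar z' (ev κ)) {x : X} (hx : x ∉ S) :
    z x = z' x := by
  classical
  by_cases hxU : x ∈ U
  · ext g
    obtain ⟨κ, hκ⟩ := hev (U ∪ S) ((Finset.card_union_le _ _).trans hUS) (Pi.single x g)
    have hvan : κ ∈ vanishing ev S := fun y hy => by
      rw [hκ y (Finset.mem_union_right _ hy), Pi.single_eq_of_ne]
      rintro rfl
      exact hx hy
    have key (z : X → AddChar G ℂ) (hz : ∀ x ∉ U, x ∉ S → z x = 0) :
        prodChar z (ev κ) = z x g := by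
      rw [prodChar_apply, Finset.prod_eq_single x]
      · rw [hκ x (Finset.mem_union_left _ hxU), Pi.single_eq_same]
      · intro y _ hy
        by_cases hyUS : y ∈ U ∪ S
        · rw [hκ y hyUS, Pi.single_eq_of_ne hy, AddChar.map_zero_eq_one]
        · simp only [Finset.mem_union, not_or] at hyUS
          rw [hz y hyUS.1 hyUS.2, AddChar.zero_apply]
      · simp
    rw [← key z hz, h κ hvan, key z' hz']
  · rw [hz x hxU hx, hz' x hxU hx]

/-- A bound for the number of product characters of weight at most `q` with prescribed restriction
to the functions vanishing on a given set of `s` points. -/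
def collisionBound (N M s q : ℕ) : ℕ :=
  ∑ j ∈ range (q + 1), N.choose j * s.choose (q - j) * M ^ (q - j)

open Classical in
theorem card_collision_le [Fintype G] {ev : K →+ (X → G)} {q : ℕ} {S : Finset X}
    (hqS : q ≤ S.card) (hev : Interpolates ev (q + S.card)) (χ : AddChar (vanishing ev S) ℂ) :
    ((lowWeight X G q).toFinite.toFinset.filter fun z =>
      (prodChar z).compAddMonoidHom (ev.comp (vanishing ev S).subtype) = χ).card ≤
      collisionBound (Fintype.card X) (Fintype.card G) S.card q := by
  set Z := (lowWeight X G q).toFinite.toFinset.filter fun z =>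
      (prodChar z).compAddMonoidHom (ev.comp (vanishing ev S).subtype) = χ with hZ
  have hsub : Z ⊆ (range (q + 1)).biUnion fun j =>
      (powersetCard j univ ×ˢ powersetCard (q - j) S).biUnion fun p =>
        Z.filter fun z => (∀ x ∉ p.1, x ∉ S → z x = 0) ∧ ∀ x ∈ S, x ∉ p.2 → z x = 0 := by
    intro z hz
    obtain ⟨V, hV, hzV⟩ : z ∈ lowWeight X G q := by
      simpa using (Finset.mem_filter.1 hz).1
    have hcard := Finset.card_inter_add_card_sdiff V S
    -- Padding `V ∩ S` makes both support sizes depend only on `j = (V \ S).card`; there is room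
    -- because `q ≤ S.card`.
    obtain ⟨W, hW₁, hW₂, hW₃⟩ := Finset.exists_subsuperset_card_eq
      (Finset.inter_subset_right : V ∩ S ⊆ S) (n := q - (V \ S).card) (by omega) (by omega)
    simp only [Finset.mem_biUnion, Finset.mem_filter, Finset.mem_product,
      Finset.mem_powersetCard, Finset.mem_range]
    refine ⟨(V \ S).card, by omega, (V \ S, W), ⟨⟨Finset.subset_univ _, rfl⟩, hW₂, hW₃⟩, hz,
      fun x hx hxS => hzV x fun h => hx (by simp [h, hxS]),
      fun x hx hxW => hzV x fun h => hxW (hW₁ (by simp [h, hx]))⟩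
  refine (Finset.card_le_card hsub).trans (Finset.card_biUnion_le.trans
    (Finset.sum_le_sum fun j hj => ?_))
  have hjq : j ≤ q := by simpa [Nat.lt_succ_iff] using hj
  refine (Finset.card_biUnion_le_card_mul _ _ (Fintype.card G ^ (q - j)) fun p hp => ?_).trans_eq
    (by rw [Finset.card_product, Finset.card_powersetCard, Finset.card_powersetCard,
      Finset.card_univ])
  simp only [Finset.mem_product, Finset.mem_powersetCard] at hp
  have hinj : Set.InjOn (fun (z : X → AddChar G ℂ) (x : p.2) => z x)
      (Z.filter fun z => (∀ x ∉ p.1, x ∉ S → z x = 0) ∧ ∀ x ∈ S, x ∉ p.2 → z x = 0) := by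
    intro z hz z' hz' h
    simp only [Finset.coe_filter, Set.mem_ofPred_eq, hZ, Finset.mem_filter] at hz hz'
    funext x
    by_cases hxS : x ∈ S
    · by_cases hxp : x ∈ p.2
      · exact congrFun h ⟨x, hxp⟩
      · rw [hz.2.2 x hxS hxp, hz'.2.2 x hxS hxp]
    -- Both families share the support `p.1` off `S`, so `q + S.card` interpolation points suffice;
    -- distinct supports could need `2q + S.card`.
    · refine eq_of_prodChar_eq_on_vanishing hev (U := p.1) (by omega) hz.2.1 hz'.2.1
        (fun κ hκ => ?_) hxS
      exact DFunLike.congr_fun (hz.1.2.trans hz'.1.2.symm) (⟨κ, hκ⟩ : vanishing ev S)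
  have := Finset.card_le_card_of_injOn (t := univ) _ (fun _ _ => Finset.mem_coe.2 (mem_univ _)) hinj
  refine this.trans_eq ?_
  rw [Finset.card_univ, Fintype.card_fun, AddChar.card_eq, Fintype.card_coe, hp.2.2]

-- Compares the mass on a coset of keys with the mean over all functions `X → G`: both are
-- controlled by the same coefficients `a`.
open Classical in
theorem sum_norm_sq_agree_le [Fintype K] [Fintype G] {ev : K →+ (X → G)} {q : ℕ} {S : Finset X}
    (hqS : q ≤ S.card) (hev : Interpolates ev (q + S.card)) {f : (X → G) → ℂ}
    (hf : f ∈ lowDegree X G q) (κ₀ : K) :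
    (∑ κ, if ∀ x ∈ S, ev κ x = ev κ₀ x then ‖f (ev κ)‖ ^ 2 else 0) / Fintype.card K ≤
      collisionBound (Fintype.card X) (Fintype.card G) S.card q / (Fintype.card G : ℝ) ^ S.card *
        ((∑ A, ‖f A‖ ^ 2) / Fintype.card (X → G)) := by
  obtain ⟨a, ha⟩ := exists_coeff_of_mem_lowDegree hf
  set s := (lowWeight X G q).toFinite.toFinset
  set T := collisionBound (Fintype.card X) (Fintype.card G) S.card q
  have hparseval : (∑ A, ‖f A‖ ^ 2) / (Fintype.card (X → G) : ℝ) = ∑ z ∈ s, ‖a z‖ ^ 2 := by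
    have := sum_norm_sq_sum_char_of_injective s a _ (prodChar_injective (X := X) (G := G))
    simp_rw [ha, this]
    rw [mul_div_cancel_left₀]
    exact_mod_cast Fintype.card_ne_zero
  have hcoset : (∑ κ, if ∀ x ∈ S, ev κ x = ev κ₀ x then ‖f (ev κ)‖ ^ 2 else 0) =
      ∑ h : vanishing ev S, ‖f (ev (κ₀ + h))‖ ^ 2 := by
    rw [← Finset.sum_filter]
    refine (Finset.sum_bij (fun (h : vanishing ev S) _ => κ₀ + h) ?_ ?_ ?_ ?_).symm
    · intro h _
      simp only [mem_filter, mem_univ, true_and]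
      intro x hx
      simp [mem_vanishing.1 h.2 x hx]
    · intro h _ h' _ hh
      simpa using hh
    · intro κ hκ
      simp only [mem_filter, mem_univ, true_and] at hκ
      exact ⟨⟨κ - κ₀, fun x hx => by simp [hκ x hx]⟩, mem_univ _, by simp⟩
    · simp
  have hbound : ∑ h : vanishing ev S, ‖f (ev (κ₀ + h))‖ ^ 2 ≤
      Fintype.card (vanishing ev S) * (T * ∑ z ∈ s, ‖a z‖ ^ 2) := by
    -- Translation by `κ₀` only multiplies the coefficients by phases of modulus one.
    have := sum_norm_sq_sum_char_le s (fun z => a z * prodChar z (ev κ₀))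
      (fun z => (prodChar z).compAddMonoidHom (ev.comp (vanishing ev S).subtype)) T
      (fun z _ => by exact_mod_cast card_collision_le hqS hev _)
    simp only [norm_mul, AddChar.norm_apply, mul_one] at this
    refine le_trans (le_of_eq (Finset.sum_congr rfl fun h _ => ?_)) this
    rw [ha]
    congr 2
    refine Finset.sum_congr rfl fun z _ => ?_
    rw [map_add, AddChar.map_add_eq_mul, mul_assoc]
    rfl
  have hker : (Fintype.card (vanishing ev S) : ℝ) * (Fintype.card G : ℝ) ^ S.card ≤
      Fintype.card K := by
    have := card_vanishing_mul_le hev (S := S) (by omega)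
    rw [Nat.card_eq_fintype_card] at this
    exact_mod_cast this
  have hG : (0 : ℝ) < Fintype.card G := by exact_mod_cast Fintype.card_pos
  have hK : (0 : ℝ) < Fintype.card K := by exact_mod_cast Fintype.card_pos
  rw [hparseval, hcoset, div_mul_eq_mul_div, div_le_div_iff₀ hK (by positivity)]
  calc _ ≤ Fintype.card (vanishing ev S) * (T * ∑ z ∈ s, ‖a z‖ ^ 2) *
        (Fintype.card G : ℝ) ^ S.card := by gcongr
    _ = (T * ∑ z ∈ s, ‖a z‖ ^ 2) *
        (Fintype.card (vanishing ev S) * (Fintype.card G : ℝ) ^ S.card) := by ring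
    _ ≤ _ := by gcongr

end Interpolation

/-! ### Estimate of the collision count -/

section Numerics

theorem collisionBound_le (N q : ℕ) :
    (collisionBound N N (q + 1) q : ℝ) ≤ ((q : ℝ) + 1) * Real.exp (2 * √(q : ℝ)) * (N : ℝ) ^ q := by
  have hterm : ∀ j ∈ range (q + 1),
      ((N.choose j * (q + 1).choose (q - j) * N ^ (q - j) : ℕ) : ℝ) ≤
        ((q : ℝ) + 1) * (N : ℝ) ^ q * (√(q : ℝ) ^ j / j.factorial) ^ 2 := by
    intro j hj
    have hjq : j ≤ q := by simpa [Nat.lt_succ_iff] using hj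
    have h₁ : (N.choose j : ℝ) ≤ (N : ℝ) ^ j / j.factorial := Nat.choose_le_pow_div j N
    have h₂ : ((q + 1).choose (q - j) : ℝ) ≤ ((q : ℝ) + 1) * ((q : ℝ) ^ j / j.factorial) := by
      -- Absorption: `(j + 1) * (q + 1).choose (j + 1) = (q + 1) * q.choose j`.
      have hle : (q + 1).choose (q - j) ≤ (q + 1) * q.choose j := by
        rw [← Nat.choose_symm_of_eq_add (show q + 1 = (j + 1) + (q - j) by omega),
          Nat.add_one_mul_choose_eq]
        exact Nat.le_mul_of_pos_right _ (Nat.succ_pos _)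
      calc ((q + 1).choose (q - j) : ℝ) ≤ ((q : ℝ) + 1) * q.choose j := by exact_mod_cast hle
        _ ≤ _ := by
          gcongr
          exact Nat.choose_le_pow_div j q
    have hN : (N : ℝ) ^ q = (N : ℝ) ^ j * (N : ℝ) ^ (q - j) := by
      rw [← pow_add, Nat.add_sub_cancel' hjq]
    push_cast
    calc (N.choose j : ℝ) * (q + 1).choose (q - j) * (N : ℝ) ^ (q - j)
        ≤ ((N : ℝ) ^ j / j.factorial) * (((q : ℝ) + 1) * ((q : ℝ) ^ j / j.factorial)) *
          (N : ℝ) ^ (q - j) := by gcongr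
      _ = _ := by
        rw [hN, div_pow, ← pow_mul, mul_comm j 2, pow_mul, Real.sq_sqrt (Nat.cast_nonneg q)]
        ring
  calc (collisionBound N N (q + 1) q : ℝ)
      ≤ ∑ j ∈ range (q + 1),
        ((q : ℝ) + 1) * (N : ℝ) ^ q * (√(q : ℝ) ^ j / j.factorial) ^ 2 := by
        rw [collisionBound, Nat.cast_sum]
        exact Finset.sum_le_sum hterm
    _ = ((q : ℝ) + 1) * (N : ℝ) ^ q *
        ∑ j ∈ range (q + 1), (√(q : ℝ) ^ j / j.factorial) ^ 2 := by rw [Finset.mul_sum]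
    _ ≤ ((q : ℝ) + 1) * (N : ℝ) ^ q * Real.exp (√(q : ℝ)) ^ 2 := by
        gcongr
        -- A sum of squares is at most the square of the sum, here a partial sum of the series for
        -- `exp √q`.
        refine (Finset.sum_sq_le_sq_sum_of_nonneg fun j _ => by positivity).trans ?_
        gcongr
        exact Real.sum_le_exp_of_nonneg (Real.sqrt_nonneg _) _
    _ = _ := by
        rw [← Real.exp_nat_mul]
        push_cast
        ring

end Numerics

/-! ### Amplitudes have degree at most the number of queries -/

section Amplitudes

variable {X Y G : Type*} [Fintype X] [Fintype Y] [AddCommGroup G]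

/-- The amplitudes of the state `ψ A` have degree at most `k` in `A`. -/
def StateDegreeLE {w : ℕ} (k : ℕ) (ψ : (X → G) → QState X Y w) : Prop :=
  ∀ b, (fun A => ψ A b) ∈ lowDegree X G k

theorem StateDegreeLE.gate {w k : ℕ} {ψ : (X → G) → QState X Y w} (hψ : StateDegreeLE k ψ)
    (U : QState X Y w ≃ₗᵢ[ℂ] QState X Y w) : StateDegreeLE k fun A => U (ψ A) := by
  classical
  intro b
  have : (fun A => U (ψ A) b) =
      ∑ b', U (EuclideanSpace.single b' 1) b • fun A => ψ A b' := by
    ext A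
    have h := (EuclideanSpace.basisFun (X × Y × Fin w) ℂ).sum_repr (ψ A)
    nth_rw 1 [← h]
    simp [mul_comm]
  rw [this]
  exact Submodule.sum_mem _ fun b' _ => Submodule.smul_mem _ _ (hψ b')

/-- A query preserves norms and raises the degree of the amplitudes by at most one. -/
structure IsQuery {w : ℕ} (query : (X → G) → QState X Y w → QState X Y w) : Prop where
  norm_eq : ∀ A ψ, ‖query A ψ‖ = ‖ψ‖
  degree_le : ∀ {k : ℕ} {ψ : (X → G) → QState X Y w}, StateDegreeLE k ψ →
    StateDegreeLE (k + 1) fun A => query A (ψ A)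

theorem isQuery_addQuery [Fintype G] {w : ℕ} :
    IsQuery fun (A : X → G) (ψ : QState X G w) => addQuery A ψ where
  norm_eq A ψ := by
    rw [← sq_eq_sq₀ (norm_nonneg _) (norm_nonneg _), EuclideanSpace.norm_sq_eq,
      EuclideanSpace.norm_sq_eq]
    simp only [addQuery, Fintype.sum_prod_type]
    refine Finset.sum_congr rfl fun x _ => ?_
    exact Fintype.sum_equiv (Equiv.subRight (A x)) _ _ fun g => rfl
  degree_le {k ψ} hψ b := by
    classical
    -- The index of the amplitude depends on `A`; splitting by the value `h` of `A b.1` fixes it at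
    -- the cost of an indicator in `A b.1`.
    have : (fun A => addQuery A (ψ A) b) =
        ∑ h, fun A => (if A b.1 = h then (1 : ℂ) else 0) * ψ A (b.1, b.2.1 - h, b.2.2) := by
      ext A
      simp [addQuery]
    rw [this]
    exact Submodule.sum_mem _ fun h _ =>
      mul_mem_lowDegree (hψ _) b.1 fun g => if g = h then 1 else 0

theorem isQuery_phaseQuery [Fintype G] {w : ℕ} :
    IsQuery fun (A : X → G) (ψ : QState X (AddChar G ℂ) w) => phaseQuery A ψ where
  norm_eq A ψ := by
    rw [← sq_eq_sq₀ (norm_nonneg _) (norm_nonneg _), EuclideanSpace.norm_sq_eq,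
      EuclideanSpace.norm_sq_eq]
    simp [phaseQuery]
  degree_le hψ b := mul_mem_lowDegree (hψ b) b.1 b.2.1

variable {q : ℕ} {Out : Type*} (Q : QueryAlgorithm X Y q Out)
  {query : (X → G) → QState X Y Q.w → QState X Y Q.w}

theorem norm_finalState (hquery : IsQuery query) (A : X → G) : ‖Q.finalState (query A)‖ = 1 := by
  have (n : ℕ) (gate : Fin n → (QState X Y Q.w ≃ₗᵢ[ℂ] QState X Y Q.w)) :
      ‖Fin.foldl n (fun ψ i => gate i (query A ψ)) Q.init‖ = 1 := by
    induction n with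
    | zero => simpa using Q.norm_init
    | succ n ih =>
      rw [Fin.foldl_succ_last, LinearIsometryEquiv.norm_map, hquery.norm_eq]
      exact ih _
  exact this q Q.gate

theorem stateDegreeLE_finalState (hquery : IsQuery query) :
    StateDegreeLE q fun A => Q.finalState (query A) := by
  have (n : ℕ) (gate : Fin n → (QState X Y Q.w ≃ₗᵢ[ℂ] QState X Y Q.w)) :
      StateDegreeLE n fun A => Fin.foldl n (fun ψ i => gate i (query A ψ)) Q.init := by
    induction n with
    | zero => exact fun b => by simpa using const_mem_lowDegree (Q.init b)
    | succ n ih =>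
      simp only [Fin.foldl_succ_last]
      exact (hquery.degree_le (ih _)).gate _
  exact this q Q.gate

end Amplitudes

/-! ### Success probability for interpolating families -/

section SuccessBound

variable {K X Y G : Type*} [Fintype K] [AddCommGroup K] [Fintype X] [Fintype Y] [Fintype G]
  [AddCommGroup G] {ev : K →+ (X → G)} {q : ℕ}

open Classical in
theorem sum_correct_le (hev : Interpolates ev (2 * q + 1)) {f : (X → G) → ℂ}
    (hf : f ∈ lowDegree X G q) (y : Fin (q + 1) → X × G) :
    (∑ κ, if CorrectPairs (ev κ) y then ‖f (ev κ)‖ ^ 2 else 0) / Fintype.card K ≤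
      collisionBound (Fintype.card X) (Fintype.card G) (q + 1) q / (Fintype.card G : ℝ) ^ (q + 1) *
        ((∑ A, ‖f A‖ ^ 2) / Fintype.card (X → G)) := by
  by_cases h : ∃ κ₀, CorrectPairs (ev κ₀) y
  · obtain ⟨κ₀, hinj, hκ₀⟩ := h
    set S := univ.image fun i => (y i).1 with hS
    have hcard : S.card = q + 1 := by
      rw [hS, Finset.card_image_of_injective _ hinj, Finset.card_univ, Fintype.card_fin]
    have hiff (κ : K) : CorrectPairs (ev κ) y ↔ ∀ x ∈ S, ev κ x = ev κ₀ x := by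
      simp only [CorrectPairs, hinj, true_and, hS, Finset.forall_mem_image, Finset.mem_univ,
        forall_true_left, hκ₀]
    have := sum_norm_sq_agree_le (S := S) (by omega)
      (by rw [hcard]; convert hev using 1; omega) hf κ₀
    simpa only [hiff, hcard] using this
  · simp only [not_exists] at h
    simp only [h, if_false, Finset.sum_const_zero, zero_div]
    positivity

theorem sum_prob_correct_le (hev : Interpolates ev (2 * q + 1))
    (Q : QueryAlgorithm X Y q (Fin (q + 1) → X × G))
    {query : (X → G) → QState X Y Q.w → QState X Y Q.w} (hquery : IsQuery query) :
    (∑ κ, Q.prob (query (ev κ)) (CorrectPairs (ev κ))) / Fintype.card K ≤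
      collisionBound (Fintype.card X) (Fintype.card G) (q + 1) q /
        (Fintype.card G : ℝ) ^ (q + 1) := by
  classical
  -- The average runs over all functions, not only members of the family.
  have hnorm : ∑ b, (∑ A : X → G, ‖Q.finalState (query A) b‖ ^ 2) / Fintype.card (X → G) =
      (1 : ℝ) := by
    rw [← Finset.sum_div, Finset.sum_comm]
    simp_rw [← EuclideanSpace.norm_sq_eq, norm_finalState Q hquery]
    simp
  simp only [QueryAlgorithm.prob]
  rw [Finset.sum_comm, Finset.sum_div]
  calc _ ≤ ∑ b, collisionBound (Fintype.card X) (Fintype.card G) (q + 1) q /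
        (Fintype.card G : ℝ) ^ (q + 1) *
        ((∑ A : X → G, ‖Q.finalState (query A) b‖ ^ 2) / Fintype.card (X → G)) := by
        refine Finset.sum_le_sum fun b _ => ?_
        convert sum_correct_le hev (stateDegreeLE_finalState Q hquery b) (Q.out b)
    _ = _ := by rw [← Finset.mul_sum, hnorm, mul_one]

end SuccessBound

/-! ### Application to polynomials and MACs -/

section Polynomials

variable {F : Type*} [Field F]

/-- Evaluation of polynomials of degree at most `d`, as a homomorphism in the coefficients. -/
def polyFunHom (F : Type*) [Field F] (d : ℕ) : (Fin (d + 1) → F) →+ (F → F) where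
  toFun := polyFun d
  map_zero' := by ext; simp [polyFun]
  map_add' c c' := by ext; simp [polyFun, Finset.sum_add_distrib]

theorem interpolates_polyFun {d k : ℕ} (hk : k ≤ d + 1) : Interpolates (polyFunHom F d) k := by
  classical
  intro U hU y
  set p := Lagrange.interpolate U id y with hp
  have hdeg : p.degree < (d + 1 : ℕ) := (Lagrange.degree_interpolate_lt y
    Function.injective_id.injOn).trans_le (by exact_mod_cast hU.trans hk)
  refine ⟨fun i => p.coeff i, fun x hx => ?_⟩
  have hsum : ∑ i : Fin (d + 1), Polynomial.monomial (i : ℕ) (p.coeff i) = p := by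
    rw [Fin.sum_univ_eq_sum_range fun i => Polynomial.monomial i (p.coeff i)]
    refine (p.as_sum_range' _ ?_).symm
    by_cases h0 : p = 0
    · simp [h0]
    · exact (Polynomial.natDegree_lt_iff_degree_lt h0).2 hdeg
  change Polynomial.eval x _ = y x
  rw [hsum]
  exact Lagrange.eval_interpolate_at_node y Function.injective_id.injOn hx

theorem sum_prob_polyFun_le {Y : Type*} [Fintype F] [Fintype Y] {q d : ℕ} (hq : 1 ≤ q)
    (hqd : (q : ℝ) ≤ (d : ℝ) / 2) (Q : QueryAlgorithm F Y q (Fin (q + 1) → F × F))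
    {query : (F → F) → QState F Y Q.w → QState F Y Q.w} (hquery : IsQuery query) :
    (∑ c, Q.prob (query (polyFun d c)) (CorrectPairs (polyFun d c))) /
      Fintype.card (Fin (d + 1) → F) ≤
      ((q : ℝ) + 1) * q * Real.exp (2 * √(q : ℝ)) / Fintype.card F := by
  have hqd' : 2 * q ≤ d := by
    have : (2 * q : ℝ) ≤ d := by linarith
    exact_mod_cast this
  refine (sum_prob_correct_le (ev := polyFunHom F d) (interpolates_polyFun (by omega)) Q
    hquery).trans ?_
  have hF : (0 : ℝ) < Fintype.card F := by exact_mod_cast Fintype.card_pos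
  have hq' : (1 : ℝ) ≤ q := by exact_mod_cast hq
  rw [div_le_div_iff₀ (by positivity) hF, pow_succ, ← mul_assoc]
  gcongr
  refine (collisionBound_le _ q).trans ?_
  gcongr
  -- The argument gives the prefactor `q + 1`; the extra factor `q ≥ 1` is slack.
  nlinarith

theorem addSuccess_polyFun_le [Fintype F] {q d : ℕ} (hq : 1 ≤ q) (hqd : (q : ℝ) ≤ (d : ℝ) / 2)
    (Q : QueryAlgorithm F F q (Fin (q + 1) → F × F)) :
    addSuccess (polyFun d) Q ≤
      ((q : ℝ) + 1) * q * Real.exp (2 * √(q : ℝ)) / Fintype.card F :=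
  sum_prob_polyFun_le hq hqd Q (query := fun A ψ => addQuery A ψ) isQuery_addQuery

theorem phaseSuccess_polyFun_le [Fintype F] {q d : ℕ} (hq : 1 ≤ q) (hqd : (q : ℝ) ≤ (d : ℝ) / 2)
    (Q : QueryAlgorithm F (AddChar F ℂ) q (Fin (q + 1) → F × F)) :
    phaseSuccess (polyFun d) Q ≤
      ((q : ℝ) + 1) * q * Real.exp (2 * √(q : ℝ)) / Fintype.card F :=
  sum_prob_polyFun_le hq hqd Q (query := fun A ψ => phaseQuery A ψ) isQuery_phaseQuery

theorem addSuccess_nonneg {K X G : Type*} [Fintype K] [Fintype X] [Fintype G] [AddCommGroup G]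
    {q k : ℕ} (A : K → X → G) (Q : QueryAlgorithm X G q (Fin k → X × G)) :
    0 ≤ addSuccess A Q := by
  refine div_nonneg (Finset.sum_nonneg fun κ _ => Finset.sum_nonneg fun b _ => ?_)
    (Nat.cast_nonneg _)
  split_ifs <;> positivity

theorem isQuantumSecureMAC_polyFun {F : ℕ → Type*} [∀ n, Field (F n)] [∀ n, Fintype (F n)]
    {q : ℕ → ℕ} (hq : ∀ n, 1 ≤ q n)
    (h : Negligible fun n =>
      ((q n : ℝ) + 1) * q n * Real.exp (2 * √(q n : ℝ)) / Fintype.card (F n)) :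
    IsQuantumSecureMAC q fun n => polyFun (F := F n) (2 * q n) := by
  intro Q
  refine Asymptotics.SuperpolynomialDecay.trans_abs_le h fun n => ?_
  rw [abs_of_nonneg (addSuccess_nonneg _ _)]
  exact (addSuccess_polyFun_le (hq n) (by push_cast; linarith) (Q n)).trans (le_abs_self _)

end Polynomials

end QuantumQuery

end

theorem theorem5p4 :
    -- the success bound, in the controlled-add and in the phase query model
    (∀ (F : Type*) [Field F] [Fintype F] (q d : ℕ), 1 ≤ q → (q : ℝ) ≤ (d : ℝ) / 2 →
      (∀ Q : QuantumQuery.QueryAlgorithm F F q (Fin (q + 1) → F × F),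
        QuantumQuery.addSuccess (QuantumQuery.polyFun (F := F) d) Q ≤
          ((q : ℝ) + 1) * q * Real.exp (2 * √(q : ℝ)) / Fintype.card F) ∧
      (∀ Q : QuantumQuery.QueryAlgorithm F (AddChar F ℂ) q (Fin (q + 1) → F × F),
        QuantumQuery.phaseSuccess (QuantumQuery.polyFun (F := F) d) Q ≤
          ((q : ℝ) + 1) * q * Real.exp (2 * √(q : ℝ)) / Fintype.card F)) ∧
    -- degree-`2q` polynomials are quantum-secure `q`-time MACs: fixed `q`
    (∀ (F : ℕ → Type*) [∀ n, Field (F n)] [∀ n, Fintype (F n)] (q : ℕ), 1 ≤ q →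
      QuantumQuery.Negligible (fun n => 1 / (Fintype.card (F n) : ℝ)) →
      QuantumQuery.IsQuantumSecureMAC (fun _ => q)
        (fun n => QuantumQuery.polyFun (F := F n) (2 * q))) ∧
    -- the same for `q` growing with the security parameter
    (∀ (F : ℕ → Type*) [∀ n, Field (F n)] [∀ n, Fintype (F n)] (q : ℕ → ℕ), (∀ n, 1 ≤ q n) →
      QuantumQuery.Negligible (fun n =>
        ((q n : ℝ) + 1) * q n * Real.exp (2 * √(q n : ℝ)) / Fintype.card (F n)) →
      QuantumQuery.IsQuantumSecureMAC q
        (fun n => QuantumQuery.polyFun (F := F n) (2 * q n))) := by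
  refine ⟨fun F _ _ q d hq hqd => ⟨QuantumQuery.addSuccess_polyFun_le hq hqd,
    QuantumQuery.phaseSuccess_polyFun_le hq hqd⟩, fun F _ _ q hq h => ?_,
    fun F _ _ q hq h => QuantumQuery.isQuantumSecureMAC_polyFun hq h⟩
  refine QuantumQuery.isQuantumSecureMAC_polyFun (fun _ => hq) ?_
  -- For fixed `q` the numerator is a constant.
  exact (Asymptotics.SuperpolynomialDecay.const_mul h
    (((q : ℝ) + 1) * q * Real.exp (2 * √(q : ℝ)))).congr fun n => mul_one_div _ _
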